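/- Let $U\subseteq\mathbb{R}^5$ be an open set (the domain of local coordinates $x^1,\dots,x^5$ on a five-dimensional manifold), and let $f_1=f_1(x^1,x^2)$, $f_2=f_2(x^3,x^4,x^5)$ and $f_3=f_3(x^3)$ be arbitrary smooth real-valued functions, each defined on the set of values that its arguments take on $U$. Let $L$ be the $(1,1)$-tensor field on $U$ whose matrix in the coordinate frame is $$ L=\begin{pmatrix} f_1 & 1 & 0 & 1 & 0\\ f_1-f_2+1 & f_1+1 & -f_3 & f_1-f_2+1 & -f_3\\ 1 & 0 & f_2+f_3 & 1 & f_3\\ f_2-f_1 & -1 & f_3 & f_2-1 & f_3\\ -1 & 0 & -f_3-1 & -1 & f_2-f_3-1 \end{pmatrix}, $$ so that $L\,\partial_j=\sum_i L^i_j\,\partial_i$. For smooth vector fields $X,Y$ on $U$ put $\tau^{(0)}_L(X,Y)=[X,Y]$ and, for $m\ge 1$, $$ \tau^{(m)}_L(X,Y)=L^2\tau^{(m-1)}_L(X,Y)+\tau^{(m-1)}_L(LX,LY)-L\bigl(\tau^{(m-1)}_L(X,LY)+\tau^{(m-1)}_L(LX,Y)\bigr), $$ so that $\tau^{(1)}_L$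 is the Nijenhuis torsion and $\mathcal{H}_L=\tau^{(2)}_L$ the Haantjes torsion of $L$. Then: 1. $\tau^{(3)}_L(X,Y)=0$ on $U$ for all smooth vector fields $X,Y$ on $U$. 2. At every point $p\in U$, the Haantjes torsion $\mathcal{H}_L$ is nonzero (that is, $\mathcal{H}_L(X,Y)(p)\ne 0$ for some smooth vector fields $X,Y$ on $U$) if and only if $f_3'(x^3(p))\neq 0$. In particular, $\mathcal{H}_L$ is not identically zero on $U$ if and only if $f_3'(x^3(p))\ne 0$ for some $p\in U$. -/

import Mathlib

open scoped ContDiff Matrix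

/-- The generalized Nijenhuis torsion of level `m` of a field of endomorphisms `A` of the tangent
spaces of (an open subset of) `E`, evaluated on two vector fields `X` and `Y`. Level `0` is the
commutator `[X, Y]`, level `1` the Nijenhuis torsion and level `2` the Haantjes torsion. -/
noncomputable def genTorsion {E : Type*} [NormedAddCommGroup E] [NormedSpace ℝ E]
    (A : E → E →L[ℝ] E) : ℕ → (E → E) → (E → E) → E → E
  | 0, X, Y => VectorField.lieBracket ℝ X Y
  | m + 1, X, Y => fun p =>
      A p (A p (genTorsion A m X Y p))
        + genTorsion A m (fun q => A q (X q)) (fun q => A q (Y q)) p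
        - A p (genTorsion A m X (fun q => A q (Y q)) p
            + genTorsion A m (fun q => A q (X q)) Y p)

/-- The matrix of the operator in the coordinate frame, where the numbers `a`, `b`, `c` are the
values of `f₁`, `f₂`, `f₃`. -/
def familyMatrix (a b c : ℝ) : Matrix (Fin 5) (Fin 5) ℝ :=
  !![a,         1,     0,      1,         0;
     a - b + 1, a + 1, -c,     a - b + 1, -c;
     1,         0,     b + c,  1,         c;
     b - a,     -1,    c,      b - 1,     c;
     -1,        0,     -c - 1, -1,        b - c - 1]

/-- The operator field `L`. The coordinates `x¹, …, x⁵` of the point `x` are `x 0, …, x 4`, and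
column `j` of the matrix holds the components of the image of the `j`-th coordinate field. -/
noncomputable def familyOperator (f₁ : ℝ × ℝ → ℝ) (f₂ : ℝ × ℝ × ℝ → ℝ) (f₃ : ℝ → ℝ)
    (x : Fin 5 → ℝ) : (Fin 5 → ℝ) →L[ℝ] (Fin 5 → ℝ) :=
  LinearMap.toContinuousLinearMap
    (Matrix.toLin' (familyMatrix (f₁ (x 0, x 1)) (f₂ (x 2, x 3, x 4)) (f₃ (x 2))))

/-! From level 1 on the torsions are tensors: at `p` they depend only on `L`, its first derivative
and the values of the fields, so everything is matrix algebra at one point. With θ = dx¹ + dx⁴, η =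
dx³ + dx⁵ and ξ = ∂₃ − ∂₅, `torsionStep_nijenhuisTensor_familyEnd` gives the Haantjes torsion as
2f₃′ (θ ∧ η) ⊗ ξ, and `torsionStep_haantjes_familyEnd` shows that one more step kills it. -/

section Tensoriality

variable {E : Type*} [NormedAddCommGroup E] [NormedSpace ℝ E]

/-- The Nijenhuis torsion at a point, as a function of the value `B` of the operator field, its
derivative `B'` and the values of the two vector fields at this point. -/
noncomputable def nijenhuisTensor (B : E →L[ℝ] E) (B' : E →L[ℝ] E →L[ℝ] E) (v w : E) : E :=
  B' (B v) w - B' (B w) v + B (B' w v) - B (B' v w)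

/-- The passage from a generalized torsion to the one of the next level, at a point. -/
def torsionStep (B : E →L[ℝ] E) (T : E → E → E) (v w : E) : E :=
  B (B (T v w)) + T (B v) (B w) - B (T v (B w) + T (B v) w)

/-- By the product rule, all terms with derivatives of `X` or `Y` cancel. -/
theorem genTorsion_one_apply {A : E → E →L[ℝ] E} {A' : E →L[ℝ] E →L[ℝ] E} {p : E}
    (hA : HasFDerivAt A A' p) {X Y : E → E}
    (hX : DifferentiableAt ℝ X p) (hY : DifferentiableAt ℝ Y p) :
    genTorsion A 1 X Y p = nijenhuisTensor (A p) A' (X p) (Y p) := by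
  have key {Z : E → E} (hZ : DifferentiableAt ℝ Z p) (v : E) :
      fderiv ℝ (fun q => A q (Z q)) p v = A p (fderiv ℝ Z p v) + A' v (Z p) := by
    rw [(hA.clm_apply hZ.hasFDerivAt).fderiv]
    simp
  simp only [genTorsion, VectorField.lieBracket, nijenhuisTensor, key hX, key hY, map_sub, map_add]
  abel

/-- `hT` covers all fields because the recursion also evaluates level `m` on `A X` and `A Y`. -/
theorem genTorsion_succ_apply {A : E → E →L[ℝ] E} {p : E} (hA : DifferentiableAt ℝ A p)
    {m : ℕ} {T : E → E → E}
    (hT : ∀ X Y : E → E, DifferentiableAt ℝ X p → DifferentiableAt ℝ Y p →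
      genTorsion A m X Y p = T (X p) (Y p))
    {X Y : E → E} (hX : DifferentiableAt ℝ X p) (hY : DifferentiableAt ℝ Y p) :
    genTorsion A (m + 1) X Y p = torsionStep (A p) T (X p) (Y p) := by
  have hAX := hA.clm_apply hX
  have hAY := hA.clm_apply hY
  simp only [genTorsion, torsionStep, hT _ _ hX hY, hT _ _ hAX hAY, hT _ _ hX hAY, hT _ _ hAX hY]

end Tensoriality

/-- The endomorphism of `ℝ⁵` with matrix `familyMatrix a b c`. -/
noncomputable def familyEnd (a b c : ℝ) : (Fin 5 → ℝ) →L[ℝ] (Fin 5 → ℝ) :=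
  LinearMap.toContinuousLinearMap (Matrix.toLin' (familyMatrix a b c))

theorem familyEnd_apply (a b c : ℝ) (v : Fin 5 → ℝ) :
    familyEnd a b c v =
      ![a * v 0 + v 1 + v 3,
        (a - b + 1) * (v 0 + v 3) + (a + 1) * v 1 - c * (v 2 + v 4),
        v 0 + v 3 + b * v 2 + c * (v 2 + v 4),
        (b - a) * v 0 - v 1 + (b - 1) * v 3 + c * (v 2 + v 4),
        -(v 0 + v 3) - (c + 1) * v 2 + (b - c - 1) * v 4] := by
  ext i
  fin_cases i <;>
    simp [familyEnd, familyMatrix, Matrix.mulVec, dotProduct, Fin.sum_univ_five] <;> ring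

/-- The linear part of the affine map `familyEnd`, in the direction `(a, b, c)`. -/
noncomputable def familyEndLinear (a b c : ℝ) : (Fin 5 → ℝ) →L[ℝ] (Fin 5 → ℝ) :=
  a • (familyEnd 1 0 0 - familyEnd 0 0 0) + b • (familyEnd 0 1 0 - familyEnd 0 0 0)
    + c • (familyEnd 0 0 1 - familyEnd 0 0 0)

theorem familyEndLinear_apply (a b c : ℝ) (v : Fin 5 → ℝ) :
    familyEndLinear a b c v =
      ![a * v 0,
        (a - b) * (v 0 + v 3) + a * v 1 - c * (v 2 + v 4),
        b * v 2 + c * (v 2 + v 4),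
        (b - a) * v 0 + b * v 3 + c * (v 2 + v 4),
        -(c * v 2) + (b - c) * v 4] := by
  ext i
  fin_cases i <;> simp [familyEndLinear, familyEnd_apply] <;> ring

theorem familyEnd_eq_add (a b c : ℝ) :
    familyEnd a b c = familyEndLinear a b c + familyEnd 0 0 0 := by
  ext v i
  fin_cases i <;> simp [familyEndLinear_apply, familyEnd_apply] <;> ring

theorem exists_hasFDerivAt_familyOperator {f₁ : ℝ × ℝ → ℝ} {f₂ : ℝ × ℝ × ℝ → ℝ} {f₃ : ℝ → ℝ}
    {p : Fin 5 → ℝ} (h₁ : DifferentiableAt ℝ f₁ (p 0, p 1))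
    (h₂ : DifferentiableAt ℝ f₂ (p 2, p 3, p 4)) (h₃ : DifferentiableAt ℝ f₃ (p 2)) :
    ∃ (A' : (Fin 5 → ℝ) →L[ℝ] (Fin 5 → ℝ) →L[ℝ] (Fin 5 → ℝ)) (α₁ α₂ β₁ β₂ β₃ : ℝ),
      HasFDerivAt (familyOperator f₁ f₂ f₃) A' p ∧
      ∀ v, A' v = familyEndLinear (α₁ * v 0 + α₂ * v 1) (β₁ * v 2 + β₂ * v 3 + β₃ * v 4)
        (deriv f₃ (p 2) * v 2) := by
  have hπ (i : Fin 5) := hasFDerivAt_apply (𝕜 := ℝ) i p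
  have d₁ := h₁.hasFDerivAt.comp p ((hπ 0).prodMk (hπ 1))
  have d₂ := h₂.hasFDerivAt.comp p ((hπ 2).prodMk ((hπ 3).prodMk (hπ 4)))
  have d₃ := h₃.hasDerivAt.comp_hasFDerivAt p (hπ 2)
  have d := (((d₁.smul_const (familyEnd 1 0 0 - familyEnd 0 0 0)).add
    (d₂.smul_const (familyEnd 0 1 0 - familyEnd 0 0 0))).add
    (d₃.smul_const (familyEnd 0 0 1 - familyEnd 0 0 0))).add_const (familyEnd 0 0 0)
  refine ⟨_, fderiv ℝ f₁ (p 0, p 1) (1, 0), fderiv ℝ f₁ (p 0, p 1) (0, 1),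
    fderiv ℝ f₂ (p 2, p 3, p 4) (1, 0, 0), fderiv ℝ f₂ (p 2, p 3, p 4) (0, 1, 0),
    fderiv ℝ f₂ (p 2, p 3, p 4) (0, 0, 1), d.congr_of_eventuallyEq (.of_forall fun x => ?_),
    fun v => ?_⟩
  · exact familyEnd_eq_add _ _ _
  · have e₁ : (v 0, v 1) = v 0 • ((1, 0) : ℝ × ℝ) + v 1 • ((0, 1) : ℝ × ℝ) := by simp
    have e₂ : (v 2, v 3, v 4) = v 2 • ((1, 0, 0) : ℝ × ℝ × ℝ) + v 3 • ((0, 1, 0) : ℝ × ℝ × ℝ)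
      + v 4 • ((0, 0, 1) : ℝ × ℝ × ℝ) := by simp
    have c₁ : fderiv ℝ f₁ (p 0, p 1) (v 0, v 1) =
        fderiv ℝ f₁ (p 0, p 1) (1, 0) * v 0 + fderiv ℝ f₁ (p 0, p 1) (0, 1) * v 1 := by
      rw [e₁, map_add, map_smul, map_smul, smul_eq_mul, smul_eq_mul]
      ring
    have c₂ : fderiv ℝ f₂ (p 2, p 3, p 4) (v 2, v 3, v 4) =
        fderiv ℝ f₂ (p 2, p 3, p 4) (1, 0, 0) * v 2 + fderiv ℝ f₂ (p 2, p 3, p 4) (0, 1, 0) * v 3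
          + fderiv ℝ f₂ (p 2, p 3, p 4) (0, 0, 1) * v 4 := by
      rw [e₂, map_add, map_add, map_smul, map_smul, map_smul, smul_eq_mul, smul_eq_mul,
        smul_eq_mul]
      ring
    rw [← c₁, ← c₂]
    simp [familyEndLinear]

section Haantjes

variable {a b c α₁ α₂ β₁ β₂ β₃ γ : ℝ} {A' : (Fin 5 → ℝ) →L[ℝ] (Fin 5 → ℝ) →L[ℝ] (Fin 5 → ℝ)}

set_option maxHeartbeats 4000000 in
theorem torsionStep_nijenhuisTensor_familyEnd
    (hA' : ∀ v, A' v = familyEndLinear (α₁ * v 0 + α₂ * v 1) (β₁ * v 2 + β₂ * v 3 + β₃ * v 4)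
      (γ * v 2)) (v w : Fin 5 → ℝ) :
    torsionStep (familyEnd a b c) (nijenhuisTensor (familyEnd a b c) A') v w =
      (2 * γ * ((v 0 + v 3) * (w 2 + w 4) - (w 0 + w 3) * (v 2 + v 4))) • ![0, 0, 1, 0, -1] := by
  ext i
  fin_cases i <;>
    simp [torsionStep, nijenhuisTensor, hA', familyEnd_apply, familyEndLinear_apply] <;> ring

/-- Here Lξ = bξ, while L*θ = bθ + cη and L*η = (b − 1)η. The step multiplies (θ ∧ η) ⊗ ξ by b² +
b(b − 1) − b(2b − 1) = 0, the characteristic polynomial of L* on span(θ, η) at its root b. -/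
theorem torsionStep_haantjes_familyEnd (v w : Fin 5 → ℝ) :
    torsionStep (familyEnd a b c) (fun v w : Fin 5 → ℝ =>
      (2 * γ * ((v 0 + v 3) * (w 2 + w 4) - (w 0 + w 3) * (v 2 + v 4))) • ![0, 0, 1, 0, -1]) v w
      = 0 := by
  ext i
  fin_cases i <;> simp [torsionStep, familyEnd_apply] <;> ring

end Haantjes

theorem genTorsion_familyOperator {f₁ : ℝ × ℝ → ℝ} {f₂ : ℝ × ℝ × ℝ → ℝ} {f₃ : ℝ → ℝ}
    {p : Fin 5 → ℝ} (h₁ : DifferentiableAt ℝ f₁ (p 0, p 1))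
    (h₂ : DifferentiableAt ℝ f₂ (p 2, p 3, p 4)) (h₃ : DifferentiableAt ℝ f₃ (p 2))
    {X Y : (Fin 5 → ℝ) → (Fin 5 → ℝ)}
    (hX : DifferentiableAt ℝ X p) (hY : DifferentiableAt ℝ Y p) :
    genTorsion (familyOperator f₁ f₂ f₃) 2 X Y p =
      (2 * deriv f₃ (p 2) * ((X p 0 + X p 3) * (Y p 2 + Y p 4) -
        (Y p 0 + Y p 3) * (X p 2 + X p 4))) • ![0, 0, 1, 0, -1] ∧
    genTorsion (familyOperator f₁ f₂ f₃) 3 X Y p = 0 := by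
  obtain ⟨A', α₁, α₂, β₁, β₂, β₃, hA, hA'⟩ := exists_hasFDerivAt_familyOperator h₁ h₂ h₃
  have haantjes (X Y : (Fin 5 → ℝ) → (Fin 5 → ℝ)) (hX : DifferentiableAt ℝ X p)
      (hY : DifferentiableAt ℝ Y p) :=
    (genTorsion_succ_apply hA.differentiableAt
      (fun _ _ hX hY => genTorsion_one_apply hA hX hY) hX hY).trans
      (torsionStep_nijenhuisTensor_familyEnd hA' (X p) (Y p))
  exact ⟨haantjes X Y hX hY, (genTorsion_succ_apply hA.differentiableAt
    (T := fun v w : Fin 5 → ℝ => (2 * deriv f₃ (p 2) * ((v 0 + v 3) * (w 2 + w 4) -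
      (w 0 + w 3) * (v 2 + v 4))) • ![0, 0, 1, 0, -1]) haantjes hX hY).trans
    (torsionStep_haantjes_familyEnd _ _)⟩

/-- By the open mapping theorem `π '' U` is a neighbourhood of `π p`. -/
theorem differentiableAt_of_contDiffOn_image {E F : Type*} [NormedAddCommGroup E]
    [NormedSpace ℝ E] [CompleteSpace E] [NormedAddCommGroup F] [NormedSpace ℝ F] [CompleteSpace F]
    {U : Set E} (hU : IsOpen U) (π : E →L[ℝ] F) (hπ : Function.Surjective π) {f : F → ℝ}
    (hf : ContDiffOn ℝ ∞ f (π '' U)) {p : E} (hp : p ∈ U) : DifferentiableAt ℝ f (π p) :=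
  (hf.contDiffAt ((π.isOpenMap hπ U hU).mem_nhds ⟨p, hp, rfl⟩)).differentiableAt (by simp)

/-- `U` is the domain of the local coordinates, and the functions `f₁`, `f₂`, `f₃` are smooth on
the (open) sets of values which their arguments take on `U`. -/
theorem mainTheorem4 (U : Set (Fin 5 → ℝ)) (hU : IsOpen U)
    (f₁ : ℝ × ℝ → ℝ) (f₂ : ℝ × ℝ × ℝ → ℝ) (f₃ : ℝ → ℝ)
    (hf₁ : ContDiffOn ℝ ∞ f₁ ((fun x : Fin 5 → ℝ => (x 0, x 1)) '' U))
    (hf₂ : ContDiffOn ℝ ∞ f₂ ((fun x : Fin 5 → ℝ => (x 2, x 3, x 4)) '' U))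
    (hf₃ : ContDiffOn ℝ ∞ f₃ ((fun x : Fin 5 → ℝ => x 2) '' U)) :
    (∀ X Y : (Fin 5 → ℝ) → (Fin 5 → ℝ), ContDiffOn ℝ ∞ X U → ContDiffOn ℝ ∞ Y U →
      ∀ p ∈ U, genTorsion (familyOperator f₁ f₂ f₃) 3 X Y p = 0) ∧
    (∀ p ∈ U,
      (∃ X Y : (Fin 5 → ℝ) → (Fin 5 → ℝ), ContDiffOn ℝ ∞ X U ∧ ContDiffOn ℝ ∞ Y U ∧
        genTorsion (familyOperator f₁ f₂ f₃) 2 X Y p ≠ 0) ↔ deriv f₃ (p 2) ≠ 0) ∧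
    ((∃ X Y : (Fin 5 → ℝ) → (Fin 5 → ℝ), ContDiffOn ℝ ∞ X U ∧ ContDiffOn ℝ ∞ Y U ∧
        ∃ p ∈ U, genTorsion (familyOperator f₁ f₂ f₃) 2 X Y p ≠ 0) ↔
      ∃ p ∈ U, deriv f₃ (p 2) ≠ 0) := by
  have h₁ {p} (hp : p ∈ U) : DifferentiableAt ℝ f₁ (p 0, p 1) :=
    differentiableAt_of_contDiffOn_image hU
      ((ContinuousLinearMap.proj (R := ℝ) (φ := fun _ : Fin 5 => ℝ) 0).prod
        (ContinuousLinearMap.proj 1))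
      (fun y => ⟨![y.1, y.2, 0, 0, 0], by simp⟩) hf₁ hp
  have h₂ {p} (hp : p ∈ U) : DifferentiableAt ℝ f₂ (p 2, p 3, p 4) :=
    differentiableAt_of_contDiffOn_image hU
      ((ContinuousLinearMap.proj (R := ℝ) (φ := fun _ : Fin 5 => ℝ) 2).prod
        ((ContinuousLinearMap.proj 3).prod (ContinuousLinearMap.proj 4)))
      (fun y => ⟨![0, 0, y.1, y.2.1, y.2.2], by simp⟩) hf₂ hp
  have h₃ {p} (hp : p ∈ U) : DifferentiableAt ℝ f₃ (p 2) :=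
    differentiableAt_of_contDiffOn_image hU
      (ContinuousLinearMap.proj (R := ℝ) (φ := fun _ : Fin 5 => ℝ) 2)
      (fun y => ⟨fun _ => y, rfl⟩) hf₃ hp
  have hd {X : (Fin 5 → ℝ) → (Fin 5 → ℝ)} (hX : ContDiffOn ℝ ∞ X U) {p} (hp : p ∈ U) :
      DifferentiableAt ℝ X p :=
    (hX.contDiffAt (hU.mem_nhds hp)).differentiableAt (by simp)
  have haantjes : ∀ p ∈ U,
      (∃ X Y : (Fin 5 → ℝ) → (Fin 5 → ℝ), ContDiffOn ℝ ∞ X U ∧ ContDiffOn ℝ ∞ Y U ∧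
        genTorsion (familyOperator f₁ f₂ f₃) 2 X Y p ≠ 0) ↔ deriv f₃ (p 2) ≠ 0 := by
    intro p hp
    constructor
    · rintro ⟨X, Y, hX, hY, h⟩ h0
      apply h
      rw [(genTorsion_familyOperator (h₁ hp) (h₂ hp) (h₃ hp) (hd hX hp) (hd hY hp)).1, h0]
      simp
    · intro h
      -- On ∂₁, ∂₃ the form θ ∧ η equals 1, so the torsion is 2f₃′ξ.
      refine ⟨fun _ => Pi.single 0 1, fun _ => Pi.single 2 1, contDiffOn_const, contDiffOn_const,
        fun h0 => h ?_⟩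
      rw [(genTorsion_familyOperator (h₁ hp) (h₂ hp) (h₃ hp) (differentiableAt_const _)
        (differentiableAt_const _)).1] at h0
      simpa [Pi.single_apply] using congrFun h0 2
  refine ⟨fun X Y hX hY p hp =>
    (genTorsion_familyOperator (h₁ hp) (h₂ hp) (h₃ hp) (hd hX hp) (hd hY hp)).2, haantjes, ?_⟩
  constructor
  · rintro ⟨X, Y, hX, hY, p, hp, h⟩
    exact ⟨p, hp, (haantjes p hp).1 ⟨X, Y, hX, hY, h⟩⟩
  · rintro ⟨p, hp, h⟩
    obtain ⟨X, Y, hX, hY, h'⟩ := (haantjes p hp).2 h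
    exact ⟨X, Y, hX, hY, p, hp, h'⟩
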